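/- Let $a,\hat c$ be real numbers with $a\neq 0,1$, and let $\mathcal F=(F_1,F_2)$ be a pair of finite sets of positive integers, not both empty, with $k_i$ the number of elements of $F_i$ and $k=k_1+k_2$. For real $b\ne 0,1$ let $$m_n^{b,\hat c}(x)=\frac{b^n}{(1-b)^n}\sum_{j=0}^n b^{-j}\binom{x}{j}\binom{-x-\hat c}{n-j}$$ be the Meixner polynomials (used below for $b=a$ and $b=1/a$). Put $$u_{\mathcal F}=\sum_{f\in F_1}f+\sum_{f\in F_2}f-\binom{k_1+1}{2}-\binom{k_2}{2}\ (\ge 0),\qquad \sigma_{\mathcal F}=\{u_{\mathcal F},u_{\mathcal F}+1,u_{\mathcal F}+2,\dots\}\setminus\{u_{\mathcal F}+f: f\in F_1\}.$$ For an integer $l\ge 0$ let $v_l(x)$ be the column vector of length $k$ with entries $m_f^{a,\hat c}(x+l)$, $f\in F_1$, followed by $m_f^{1/a,\hat c}(x+l)/a^{l}$, $f\in F_2$ (the elements of $F_1$ and of $F_2$ being taken in increasing order). Define the polynomials $$\Omega_{\mathcal F}^{a,\hat c}(x)=\det\big(v_0(x),v_1(x),\dots,v_{k-1}(x)\big),\qquad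 \Lambda_{\mathcal F}^{a,\hat c}(x)=\det\big(v_0(x),\dots,v_{k-2}(x),v_k(x)\big),$$ and, for $n\in\sigma_{\mathcal F}$, $$m_n^{a,\hat c;\mathcal F}(x)=\det\begin{pmatrix} m_{n-u_{\mathcal F}}^{a,\hat c}(x)& m_{n-u_{\mathcal F}}^{a,\hat c}(x+1)&\cdots & m_{n-u_{\mathcal F}}^{a,\hat c}(x+k)\\ v_0(x)&v_1(x)&\cdots&v_k(x)\end{pmatrix}.$$ Then $\Omega_{\mathcal F}^{a,\hat c}$ is not the zero polynomial, and the polynomials $m_n^{a,\hat c;\mathcal F}$, $n\in\sigma_{\mathcal F}$, are nonzero common eigenfunctions of the second order difference operator with rational coefficients $$D_{\mathcal F}=h_{-1}(x)\,\mathfrak S_{-1}+h_0(x)\,\mathfrak S_0+h_1(x)\,\mathfrak S_1,\qquad (\mathfrak S_l p)(x)=p(x+l),$$ where, with $\Delta f(x)=f(x+1)-f(x)$, $$h_{-1}(x)=\frac{x\,\Omega^{a,\hat c}_{\mathcal F}(x+1)}{(a-1)\,\Omega^{a,\hat c}_{\mathcal F}(x)},\qquad h_1(x)=\frac{a(x+\hat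 c+k)\,\Omega^{a,\hat c}_{\mathcal F}(x)}{(a-1)\,\Omega^{a,\hat c}_{\mathcal F}(x+1)},$$ $$h_0(x)=-\frac{(1+a)(x+k)+a\hat c}{a-1}+u_{\mathcal F}+\Delta\left(\frac{a(x+\hat c+k-1)\,\Lambda^{a,\hat c}_{\mathcal F}(x)}{(a-1)\,\Omega^{a,\hat c}_{\mathcal F}(x)}\right).$$ Moreover, $D_{\mathcal F}\big(m_n^{a,\hat c;\mathcal F}\big)=n\,m_n^{a,\hat c;\mathcal F}$ for every $n\in\sigma_{\mathcal F}$, as an identity of rational functions of $x$. -/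

import Mathlib

noncomputable section

open Polynomial

namespace ExceptionalMeixner

/-- The binomial coefficient `binom(p, j) = p (p - 1) ⋯ (p - j + 1) / j!` of a real polynomial `p`. -/
def polyBinom (p : ℝ[X]) (j : ℕ) : ℝ[X] :=
  C ((j.factorial : ℝ)⁻¹) * (descPochhammer ℝ j).comp p

/-- The Meixner polynomial
`m_n^{a,c}(x) = a^n / (1 - a)^n * ∑_{j=0}^n a^{-j} binom(x, j) binom(-x - c, n - j)`. -/
def meixner (a c : ℝ) (n : ℕ) : ℝ[X] :=
  C (a ^ n / (1 - a) ^ n) *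
    ∑ j ∈ Finset.range (n + 1),
      C ((a ^ j)⁻¹) * polyBinom X j * polyBinom (-X - C c) (n - j)

/-- The shifted Meixner polynomial `m_n^{a,c}(x + l)`. -/
def meixnerShift (a c : ℝ) (n l : ℕ) : ℝ[X] :=
  (meixner a c n).comp (X + C (l : ℝ))

/-- The rows indexed by `F₁` and then `F₂`, each in increasing order: the entry at shift `l` is
`m_f^{a,c}(x + l)` for `f ∈ F₁` and `m_f^{1/a,c}(x + l) / a^l` for `f ∈ F₂`. -/
def rows (a c : ℝ) (F₁ F₂ : Finset ℕ) : Fin (F₁.card + F₂.card) → ℕ → ℝ[X] :=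
  Fin.append
    (fun i l => meixnerShift a c (F₁.orderEmbOfFin rfl i) l)
    (fun i l => C ((a ^ l)⁻¹) * meixnerShift (1 / a) c (F₂.orderEmbOfFin rfl i) l)

/-- The polynomial `Ω_F^{a,c}`: columns at shifts `0, 1, …, k - 1`, with `k = |F₁| + |F₂|`. -/
def Omega (a c : ℝ) (F₁ F₂ : Finset ℕ) : ℝ[X] :=
  Matrix.det (Matrix.of fun i j : Fin (F₁.card + F₂.card) => rows a c F₁ F₂ i j)

/-- The polynomial `Λ_F^{a,c}`: columns at shifts `0, 1, …, k - 2, k`. -/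
def Lambda (a c : ℝ) (F₁ F₂ : Finset ℕ) : ℝ[X] :=
  Matrix.det (Matrix.of fun i j : Fin (F₁.card + F₂.card) =>
    rows a c F₁ F₂ i (if (j : ℕ) + 1 = F₁.card + F₂.card then F₁.card + F₂.card else j))

theorem choose_card_succ_le_sum (F : Finset ℕ) (hF : ∀ f ∈ F, 0 < f) :
    (F.card + 1).choose 2 ≤ ∑ f ∈ F, f := by
  induction hn : F.card generalizing F with
  | zero => simp
  | succ n ih =>
    have hne : F.Nonempty := Finset.card_pos.mp (by omega)
    have hmem := F.max'_mem hne
    have hcard : (F.erase (F.max' hne)).card = n := by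
      rw [Finset.card_erase_of_mem hmem]; omega
    have h1 := ih (F.erase (F.max' hne)) (fun f hf => hF f (Finset.mem_of_mem_erase hf)) hcard
    have h2 : F.card ≤ F.max' hne := by
      have : F ⊆ Finset.Icc 1 (F.max' hne) := fun f hf =>
        Finset.mem_Icc.mpr ⟨hF f hf, F.le_max' f hf⟩
      simpa using Finset.card_le_card this
    rw [← Finset.add_sum_erase F (fun f => f) hmem, Nat.choose_succ_succ' (n + 1) 1,
      Nat.choose_one_right]
    norm_num
    omega

/-- `u_F = ∑_{f ∈ F₁} f + ∑_{f ∈ F₂} f - binom(k₁ + 1, 2) - binom(k₂, 2)`. -/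
def u (F₁ F₂ : Finset ℕ) : ℕ :=
  ∑ f ∈ F₁, f + ∑ f ∈ F₂, f - (F₁.card + 1).choose 2 - F₂.card.choose 2

/-- For sets of positive integers the subtractions in the definition of `u_F` do not truncate. -/
theorem u_cast (F₁ F₂ : Finset ℕ) (h₁ : ∀ f ∈ F₁, 0 < f) (h₂ : ∀ f ∈ F₂, 0 < f) :
    (u F₁ F₂ : ℤ) = ∑ f ∈ F₁, (f : ℤ) + ∑ f ∈ F₂, (f : ℤ)
      - ((F₁.card + 1).choose 2 : ℤ) - (F₂.card.choose 2 : ℤ) := by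
  have e₁ := choose_card_succ_le_sum F₁ h₁
  have e₂ := choose_card_succ_le_sum F₂ h₂
  have e₃ : F₂.card.choose 2 ≤ (F₂.card + 1).choose 2 := Nat.choose_le_succ _ _
  unfold u
  rw [← Nat.cast_sum, ← Nat.cast_sum]
  omega

/-- `σ_F = {u_F, u_F + 1, u_F + 2, …} \ {u_F + f : f ∈ F₁}`. -/
def sigma (F₁ F₂ : Finset ℕ) : Set ℕ :=
  Set.Ici (u F₁ F₂) \ {n | ∃ f ∈ F₁, n = u F₁ F₂ + f}

/-- The polynomial `m_n^{a,c;F}` for `n ≥ u_F`: the `(k + 1) × (k + 1)` determinant with first row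
`m_{n - u_F}^{a,c}(x + l)`, followed by the rows of `F₁` and `F₂`, at shifts `l = 0, 1, …, k`. -/
def excMeixner (a c : ℝ) (F₁ F₂ : Finset ℕ) (n : ℕ) : ℝ[X] :=
  Matrix.det (Matrix.of fun i j : Fin (F₁.card + F₂.card + 1) =>
    (Fin.cons (fun l => meixnerShift a c (n - u F₁ F₂) l) (rows a c F₁ F₂) :
      Fin (F₁.card + F₂.card + 1) → ℕ → ℝ[X]) i j)

theorem nonZeroDivisors_le_comap_taylor (r : ℝ) :
    nonZeroDivisors ℝ[X] ≤ (nonZeroDivisors ℝ[X]).comap (taylorAlgHom r) :=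
  nonZeroDivisors_le_comap_nonZeroDivisors_of_injective _ (taylor_injective r)

/-- The shift `S_r` on rational functions, `(S_r f)(x) = f(x + r)`. -/
def shift (r : ℝ) : RatFunc ℝ →ₐ[ℝ] RatFunc ℝ :=
  RatFunc.mapAlgHom (taylorAlgHom r) (nonZeroDivisors_le_comap_taylor r)

/-- On a quotient of polynomials, `shift r` replaces `x` by `x + r`. -/
theorem shift_div (r : ℝ) (p q : ℝ[X]) :
    shift r (algebraMap ℝ[X] (RatFunc ℝ) p / algebraMap ℝ[X] (RatFunc ℝ) q) =
      algebraMap ℝ[X] (RatFunc ℝ) (p.comp (X + C r)) /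
        algebraMap ℝ[X] (RatFunc ℝ) (q.comp (X + C r)) := by
  have h : ∀ p : ℝ[X], shift r (algebraMap ℝ[X] (RatFunc ℝ) p) =
      algebraMap ℝ[X] (RatFunc ℝ) (p.comp (X + C r)) := fun p => by
    have h := RatFunc.map_apply_div (taylorAlgHom r) (nonZeroDivisors_le_comap_taylor r) p 1
    simp only [map_one, div_one] at h
    rw [← taylor_apply]
    exact h
  rw [map_div₀, h, h]

/-- The difference operator `Δ f = f(x + 1) - f(x)` on rational functions. -/
def delta (f : RatFunc ℝ) : RatFunc ℝ := shift 1 f - f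

/-- `Ω_F^{a,c}` as a rational function. -/
def OmegaR (a c : ℝ) (F₁ F₂ : Finset ℕ) : RatFunc ℝ := algebraMap ℝ[X] (RatFunc ℝ) (Omega a c F₁ F₂)

/-- `Λ_F^{a,c}` as a rational function. -/
def LambdaR (a c : ℝ) (F₁ F₂ : Finset ℕ) : RatFunc ℝ :=
  algebraMap ℝ[X] (RatFunc ℝ) (Lambda a c F₁ F₂)

/-- `h_{-1}(x) = x Ω(x + 1) / ((a - 1) Ω(x))`. -/
def hNeg (a c : ℝ) (F₁ F₂ : Finset ℕ) : RatFunc ℝ :=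
  RatFunc.X * shift 1 (OmegaR a c F₁ F₂) / (RatFunc.C (a - 1) * OmegaR a c F₁ F₂)

/-- `h_0(x) = -((1 + a)(x + k) + a c) / (a - 1) + u_F + Δ(a (x + c + k - 1) Λ(x) / ((a - 1) Ω(x)))`. -/
def hZero (a c : ℝ) (F₁ F₂ : Finset ℕ) : RatFunc ℝ :=
  -((RatFunc.C (1 + a) * (RatFunc.X + RatFunc.C ((F₁.card + F₂.card : ℕ) : ℝ))
      + RatFunc.C (a * c)) / RatFunc.C (a - 1))
    + RatFunc.C (u F₁ F₂ : ℝ)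
    + delta
        (RatFunc.C a * (RatFunc.X + RatFunc.C (c + ((F₁.card + F₂.card : ℕ) : ℝ) - 1))
            * LambdaR a c F₁ F₂
          / (RatFunc.C (a - 1) * OmegaR a c F₁ F₂))

/-- `h_1(x) = a (x + c + k) Ω(x) / ((a - 1) Ω(x + 1))`. -/
def hPos (a c : ℝ) (F₁ F₂ : Finset ℕ) : RatFunc ℝ :=
  RatFunc.C a * (RatFunc.X + RatFunc.C (c + ((F₁.card + F₂.card : ℕ) : ℝ))) * OmegaR a c F₁ F₂
    / (RatFunc.C (a - 1) * shift 1 (OmegaR a c F₁ F₂))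

/-- The second order difference operator `D_F = h_{-1} S_{-1} + h_0 S_0 + h_1 S_1`. -/
def D (a c : ℝ) (F₁ F₂ : Finset ℕ) : Module.End ℝ (RatFunc ℝ) :=
  LinearMap.mulLeft ℝ (hNeg a c F₁ F₂) ∘ₗ (shift (-1)).toLinearMap
    + LinearMap.mulLeft ℝ (hZero a c F₁ F₂) ∘ₗ (shift 0).toLinearMap
    + LinearMap.mulLeft ℝ (hPos a c F₁ F₂) ∘ₗ (shift 1).toLinearMap

theorem D_apply (a c : ℝ) (F₁ F₂ : Finset ℕ) (f : RatFunc ℝ) :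
    D a c F₁ F₂ f = hNeg a c F₁ F₂ * shift (-1) f + hZero a c F₁ F₂ * shift 0 f
      + hPos a c F₁ F₂ * shift 1 f := by
  simp [D]

end ExceptionalMeixner

end

/-!
The Meixner polynomials are eigenfunctions, with eigenvalue `n`, of the operator
`L = (x S₋₁ - ((1 + a) x + a c) + a (x + c) S₁) / (a - 1)`. This follows from the generating
function `(1 + w / a) ^ x (1 + w) ^ (-x - c)`, on which `L` acts as `w d/dw`
(`meixnerSeries_diff`, `meixner_diff`). The functions `a ^ (-x) m_f^{1/a,c}(x)` are eigenfunctions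
of the same operator `L`, with eigenvalue `-(f + c)` (`rows_diff`). Hence `Ω` and the polynomials
`m_n^{a,c;F}` are, up to powers of `a`, Casorati determinants of eigenfunctions of one second
order operator.

The eigenvalue equation is then an instance of the Crum (iterated Darboux) transformation, which
holds for every second order difference operator (`casorati_crum`). Let `M` send `f` to the Casorati
determinant of `f` and the `k` chosen eigenfunctions. The coefficients of `D` are the ones for which
the extreme coefficients of `(D - u) M - M L` cancel. What is left is an operator of order less than
`k` that annihilates the `k` chosen eigenfunctions, and it is zero because their Casorati
determinant does not vanish.

The nonvanishing of `Ω` and of `m_n^{a,c;F}` is a statement about quasi-polynomials `β ^ x p(x)`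
with distinct pairs `(β, deg p)` (`det_quasiPoly_ne_zero`). Passing from `k` quasi-polynomials to
the `2 × 2` Casorati determinants of the first with each of the others lowers `k` by one and keeps the
pairs distinct, because the degree of the determinant is `deg p + deg q`, minus one exactly if the
bases agree (`natDegree_quasiWronskian`).
-/

namespace ExceptionalMeixner

open Polynomial

/-! ### The difference equation and the degree of the Meixner polynomials -/

theorem polyBinom_zero (p : ℝ[X]) : polyBinom p 0 = 1 := by
  simp [polyBinom]

theorem polyBinom_comp (p q : ℝ[X]) (j : ℕ) : (polyBinom p j).comp q = polyBinom (p.comp q) j := by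
  simp [polyBinom, comp_assoc]

theorem succ_mul_inv_factorial (j : ℕ) :
    (C ((j : ℝ) + 1) : ℝ[X]) * C (((j + 1).factorial : ℝ)⁻¹) = C ((j.factorial : ℝ)⁻¹) := by
  rw [← C_mul, Nat.factorial_succ]
  congr 1
  have : (j.factorial : ℝ) ≠ 0 := by positivity
  push_cast
  field_simp

theorem succ_mul_polyBinom_succ (p : ℝ[X]) (j : ℕ) :
    C ((j : ℝ) + 1) * polyBinom p (j + 1) = (p - C (j : ℝ)) * polyBinom p j := by
  rw [polyBinom, ← mul_assoc, succ_mul_inv_factorial, descPochhammer_succ_right, polyBinom]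
  simp only [mul_comp, sub_comp, X_comp, natCast_comp, map_natCast]
  ring

theorem succ_mul_polyBinom_succ' (p : ℝ[X]) (j : ℕ) :
    C ((j : ℝ) + 1) * polyBinom p (j + 1) = p * polyBinom (p - 1) j := by
  rw [polyBinom, ← mul_assoc, succ_mul_inv_factorial, descPochhammer_succ_left, polyBinom]
  simp only [mul_comp, sub_comp, X_comp, comp_assoc, one_comp]
  ring

theorem polyBinom_pascal (p : ℝ[X]) (j : ℕ) :
    polyBinom (p + 1) (j + 1) = polyBinom p (j + 1) + polyBinom p j := by
  have h : (C ((j : ℝ) + 1) : ℝ[X]) ≠ 0 := C_ne_zero.mpr (by positivity)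
  apply mul_left_cancel₀ h
  rw [succ_mul_polyBinom_succ', add_sub_cancel_right, mul_add, succ_mul_polyBinom_succ, C_add, C_1]
  ring

theorem natDegree_polyBinom_le (p : ℝ[X]) (hp : p.natDegree ≤ 1) (j : ℕ) :
    (polyBinom p j).natDegree ≤ j ∧ (polyBinom p j).coeff j = p.coeff 1 ^ j / j.factorial := by
  induction j with
  | zero => simp [polyBinom_zero]
  | succ j ih =>
    have hd : (p - C (j : ℝ)).natDegree ≤ 1 := (natDegree_sub_C).trans_le hp
    have hne : ((j : ℝ) + 1) ≠ 0 := by positivity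
    have h : polyBinom p (j + 1) = C (((j : ℝ) + 1)⁻¹) * ((p - C (j : ℝ)) * polyBinom p j) := by
      rw [← succ_mul_polyBinom_succ, ← mul_assoc, ← C_mul, inv_mul_cancel₀ hne, C_1, one_mul]
    constructor
    · rw [h]
      refine (natDegree_C_mul_le _ _).trans (natDegree_mul_le.trans ?_)
      have := ih.1
      omega
    · rw [h, coeff_C_mul, add_comm j 1, coeff_mul_add_eq_of_natDegree_le hd ih.1, ih.2, coeff_sub,
        coeff_C_of_ne_zero one_ne_zero, add_comm 1 j, Nat.factorial_succ]
      push_cast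
      field_simp
      ring

/-- The Meixner polynomials have degree `n` for every value of `c`: the coefficient of `x ^ n`
is `1 / n!` by the binomial theorem. -/
theorem natDegree_meixner {a : ℝ} (c : ℝ) (ha₀ : a ≠ 0) (ha₁ : a ≠ 1) (n : ℕ) :
    meixner a c n ≠ 0 ∧ (meixner a c n).natDegree = n := by
  have hd : (-X - C c : ℝ[X]).natDegree ≤ 1 := by compute_degree
  have h1 : (X : ℝ[X]).natDegree ≤ 1 := natDegree_X_le
  have hle : (meixner a c n).natDegree ≤ n := by
    refine (natDegree_C_mul_le _ _).trans (natDegree_sum_le_of_forall_le _ _ fun j hj => ?_)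
    have hj' := Finset.mem_range_succ_iff.mp hj
    rw [mul_assoc]
    refine (natDegree_C_mul_le _ _).trans (natDegree_mul_le.trans ?_)
    have e1 := (natDegree_polyBinom_le X h1 j).1
    have e2 := (natDegree_polyBinom_le _ hd (n - j)).1
    omega
  have hcoeff : (meixner a c n).coeff n = 1 / n.factorial := by
    have h1a : (1 - a) ≠ 0 := sub_ne_zero.mpr ha₁.symm
    have key : ∑ j ∈ Finset.range (n + 1),
        (C ((a ^ j)⁻¹) * polyBinom X j * polyBinom (-X - C c) (n - j)).coeff n
        = (a⁻¹ + -1) ^ n / n.factorial := by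
      rw [add_pow, Finset.sum_div]
      refine Finset.sum_congr rfl fun j hj => ?_
      have hj' := Finset.mem_range_succ_iff.mp hj
      have e1 := natDegree_polyBinom_le X h1 j
      have e2 := natDegree_polyBinom_le _ hd (n - j)
      have e3 := coeff_mul_add_eq_of_natDegree_le e1.1 e2.1
      rw [Nat.add_sub_cancel' hj'] at e3
      rw [mul_assoc, coeff_C_mul, e3, e1.2, e2.2, Nat.cast_choose ℝ hj']
      have f1 : (n.factorial : ℝ) ≠ 0 := by positivity
      have f2 : (j.factorial : ℝ) ≠ 0 := by positivity
      have f3 : ((n - j).factorial : ℝ) ≠ 0 := by positivity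
      simp
      field_simp
    rw [meixner, coeff_C_mul, finsetSum_coeff, key, ← div_pow, mul_div_assoc', ← mul_pow]
    have : a / (1 - a) * (a⁻¹ + -1) = 1 := by field_simp; ring
    rw [this, one_pow]
  have hne : (meixner a c n).coeff n ≠ 0 := by rw [hcoeff]; positivity
  exact ⟨fun h => hne (by simp [h]), le_antisymm hle (le_natDegree_of_ne_zero hne)⟩

/-- The binomial series `(1 + t w) ^ p` in the variable `w`, with polynomial exponent `p`. -/
noncomputable def binomSeries (p : ℝ[X]) (t : ℝ) : PowerSeries ℝ[X] :=
  PowerSeries.mk fun j => C (t ^ j) * polyBinom p j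

theorem binomSeries_add_one (p : ℝ[X]) (t : ℝ) :
    binomSeries (p + 1) t = (1 + PowerSeries.C (C t) * PowerSeries.X) * binomSeries p t := by
  ext1 n
  rw [add_mul, one_mul, mul_assoc, map_add, PowerSeries.coeff_C_mul]
  cases n with
  | zero => simp [binomSeries, polyBinom_zero]
  | succ n =>
    rw [PowerSeries.coeff_succ_X_mul]
    simp only [binomSeries, PowerSeries.coeff_mk, polyBinom_pascal, pow_succ, C_mul]
    ring

/-- The Leibniz rule as an equation between products, over an arbitrary ring: over `ℝ[X]` the
scalar action in `Derivation.leibniz` meets a second algebra structure on power series. -/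
theorem powerSeries_derivative_mul {R : Type*} [CommRing R] (f g : PowerSeries R) :
    PowerSeries.derivative R (f * g)
      = f * PowerSeries.derivative R g + g * PowerSeries.derivative R f :=
  Derivation.leibniz _ _ _

theorem derivative_binomSeries (p : ℝ[X]) (t : ℝ) :
    PowerSeries.derivative ℝ[X] (binomSeries p t)
      = PowerSeries.C (C t * p) * binomSeries (p - 1) t := by
  ext1 n
  rw [PowerSeries.coeff_derivative, PowerSeries.coeff_C_mul]
  simp only [binomSeries, PowerSeries.coeff_mk]
  have h := succ_mul_polyBinom_succ' p n
  rw [C_add, C_1, map_natCast] at h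
  rw [pow_succ, C_mul]
  linear_combination (C (t ^ n) * C t) * h

/-- The generating function `(1 + w / a) ^ q * (1 + w) ^ (-q - c)` of the Meixner polynomials
at `q`, up to rescaling `w`. -/
noncomputable def meixnerSeries (a c : ℝ) (q : ℝ[X]) : PowerSeries ℝ[X] :=
  binomSeries q a⁻¹ * binomSeries (-q - C c) 1

theorem meixner_comp_eq_coeff (a c : ℝ) (n : ℕ) (q : ℝ[X]) :
    (meixner a c n).comp q
      = C (a ^ n / (1 - a) ^ n) * PowerSeries.coeff n (meixnerSeries a c q) := by
  rw [meixner, meixnerSeries, PowerSeries.coeff_mul,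
    Finset.Nat.sum_antidiagonal_eq_sum_range_succ_mk, mul_comp, C_comp, Polynomial.sum_comp]
  simp [binomSeries, polyBinom_comp, mul_comp, mul_assoc]

/-- On the generating function the Meixner difference operator acts as the Euler operator
`w * d/dw`. -/
theorem meixnerSeries_diff {a : ℝ} (c : ℝ) (ha₀ : a ≠ 0) (q : ℝ[X]) :
    PowerSeries.C q * meixnerSeries a c (q - 1)
      - PowerSeries.C (C (1 + a) * q + C (a * c)) * meixnerSeries a c q
      + PowerSeries.C (C a * (q + C c)) * meixnerSeries a c (q + 1)
    = PowerSeries.C (C (a - 1))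
      * (PowerSeries.derivative ℝ[X] (meixnerSeries a c q) * PowerSeries.X) := by
  have hta : (PowerSeries.C (C a) : PowerSeries ℝ[X]) * PowerSeries.C (C a⁻¹) = 1 := by
    rw [← map_mul, ← C_mul, mul_inv_cancel₀ ha₀]; simp
  have h1 : -(q + 1) - C c = -q - C c - 1 := by ring
  have h2 : -(q - 1) - C c = -q - C c + 1 := by ring
  have e1 := binomSeries_add_one (q - 1) a⁻¹
  have e2 := binomSeries_add_one q a⁻¹
  have e3 := binomSeries_add_one (-q - C c - 1) 1
  have e4 := binomSeries_add_one (-q - C c) 1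
  rw [sub_add_cancel] at e1 e3
  unfold meixnerSeries
  rw [h1, h2, powerSeries_derivative_mul, derivative_binomSeries, derivative_binomSeries,
    e2, e4, e1, e3]
  simp only [map_mul, map_add, map_sub, map_neg, map_one]
  generalize binomSeries (q - 1) a⁻¹ = P
  generalize binomSeries (-q - C c - 1) 1 = Q
  generalize PowerSeries.C (C a⁻¹) = t at *
  generalize PowerSeries.C (C a) = s at *
  generalize PowerSeries.C (C c) = d
  generalize PowerSeries.C q = y
  generalize (PowerSeries.X : PowerSeries ℝ[X]) = w
  linear_combination P * Q * w * ((y + d) * (1 + t * w) - y * (1 + w)) * hta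

/-- The second order difference equation of the Meixner polynomials, evaluated at `q`. -/
theorem meixner_diff {a : ℝ} (c : ℝ) (ha₀ : a ≠ 0) (n : ℕ) (q : ℝ[X]) :
    q * (meixner a c n).comp (q - 1)
      - (C (1 + a) * q + C (a * c)) * (meixner a c n).comp q
      + C a * (q + C c) * (meixner a c n).comp (q + 1)
    = C (a - 1) * C (n : ℝ) * (meixner a c n).comp q := by
  have h := congrArg (PowerSeries.coeff n) (meixnerSeries_diff c ha₀ q)
  have hX : PowerSeries.coeff n
      (PowerSeries.derivative ℝ[X] (meixnerSeries a c q) * PowerSeries.X)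
      = C (n : ℝ) * PowerSeries.coeff n (meixnerSeries a c q) := by
    cases n with
    | zero => simp
    | succ n =>
      rw [PowerSeries.coeff_succ_mul_X, PowerSeries.coeff_derivative]
      simp [mul_comm]
  rw [map_add, map_sub, PowerSeries.coeff_C_mul, PowerSeries.coeff_C_mul, PowerSeries.coeff_C_mul,
    PowerSeries.coeff_C_mul, hX] at h
  simp only [meixner_comp_eq_coeff]
  linear_combination C (a ^ n / (1 - a) ^ n) * h

/-! ### Casorati determinants of quasi-polynomials -/

/-- The sequence `l ↦ β ^ l p(x + l)` of polynomials, that is, the shifts of the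
quasi-polynomial `β ^ x p(x)` with the common factor `β ^ x` removed. -/
noncomputable def quasiPoly (β : ℝ) (p : ℝ[X]) (l : ℕ) : ℝ[X] :=
  C (β ^ l) * p.comp (X + C (l : ℝ))

/-- The polynomial factor of the `2 × 2` Casorati determinant of `β ^ x p(x)` and `γ ^ x q(x)`,
which is the quasi-polynomial with base `β γ` and this factor. -/
noncomputable def quasiWronskian (β γ : ℝ) (p q : ℝ[X]) : ℝ[X] :=
  C γ * p * taylor 1 q - C β * taylor 1 p * q

theorem quasiPoly_wronskian (β γ : ℝ) (p q : ℝ[X]) (l : ℕ) :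
    quasiPoly β p l * quasiPoly γ q (l + 1) - quasiPoly β p (l + 1) * quasiPoly γ q l
      = quasiPoly (β * γ) (quasiWronskian β γ p q) l := by
  have h : ∀ f : ℝ[X], (taylor 1 f).comp (X + C (l : ℝ)) = f.comp (X + C ((l + 1 : ℕ) : ℝ)) := by
    intro f
    rw [taylor_apply, comp_assoc]
    congr 1
    simp [add_assoc]
  simp only [quasiPoly, quasiWronskian, sub_comp, mul_comp, C_comp, h, pow_succ, mul_pow, C_mul]
  ring

/-- The difference `p(x + 1) - p(x)` has degree less than `deg p`, with coefficient of degree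
`deg p - 1` equal to `deg p` times the leading coefficient of `p`. The factor `X` avoids the
truncated subtraction when `deg p = 0`. -/
theorem natDegree_X_mul_taylor_sub (p : ℝ[X]) :
    (X * (taylor 1 p - p)).natDegree ≤ p.natDegree ∧
      (X * (taylor 1 p - p)).coeff p.natDegree = p.natDegree * p.leadingCoeff := by
  rcases Nat.eq_zero_or_pos p.natDegree with h0 | hpos
  · rw [eq_C_of_natDegree_eq_zero h0]
    simp
  · obtain ⟨m, hm⟩ : ∃ m, p.natDegree = m + 1 := ⟨p.natDegree - 1, by omega⟩
    have hcoeff : ∀ i, m < i → (taylor 1 p - p).coeff i = 0 := by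
      intro i hi
      rcases Nat.lt_or_ge p.natDegree i with h | h
      · rw [coeff_sub, coeff_eq_zero_of_natDegree_lt h,
          coeff_eq_zero_of_natDegree_lt (by rwa [natDegree_taylor]), sub_zero]
      · obtain rfl : i = p.natDegree := by omega
        rw [coeff_sub, coeff_taylor_natDegree, leadingCoeff, sub_self]
    have hm' : (taylor 1 p - p).coeff m = (m + 1) * p.leadingCoeff := by
      have hd : (hasseDeriv m p).natDegree < 2 := by
        have := natDegree_hasseDeriv_le p m
        omega
      rw [coeff_sub, taylor_coeff, eval_eq_sum_range' hd, Finset.sum_range_succ,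
        Finset.sum_range_one, hasseDeriv_coeff, hasseDeriv_coeff, leadingCoeff, hm]
      simp [add_comm 1 m]
    constructor
    · refine natDegree_mul_le.trans ?_
      have : (taylor 1 p - p).natDegree ≤ m := natDegree_le_iff_coeff_eq_zero.mpr hcoeff
      rw [natDegree_X]
      omega
    · rw [hm, coeff_X_mul, hm']
      push_cast
      ring

/-- The degree of the Wronskian drops by one exactly when the two exponential bases agree. -/
theorem natDegree_quasiWronskian {β γ : ℝ} {p q : ℝ[X]} (hp : p ≠ 0) (hq : q ≠ 0)
    (h : β = γ → p.natDegree ≠ q.natDegree) (hβ : β ≠ 0) :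
    quasiWronskian β γ p q ≠ 0 ∧ (quasiWronskian β γ p q).natDegree + (if β = γ then 1 else 0)
      = p.natDegree + q.natDegree := by
  have hlc : p.leadingCoeff * q.leadingCoeff ≠ 0 :=
    mul_ne_zero (leadingCoeff_ne_zero.mpr hp) (leadingCoeff_ne_zero.mpr hq)
  split_ifs with hβγ
  · subst hβγ
    have e : X * quasiWronskian β β p q
        = C β * (p * (X * (taylor 1 q - q)) - (X * (taylor 1 p - p)) * q) := by
      rw [quasiWronskian]; ring
    have dp := natDegree_X_mul_taylor_sub p
    have dq := natDegree_X_mul_taylor_sub q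
    have hc : (X * quasiWronskian β β p q).coeff (p.natDegree + q.natDegree) ≠ 0 := by
      rw [e, coeff_C_mul, coeff_sub, coeff_mul_add_eq_of_natDegree_le le_rfl dq.1,
        coeff_mul_add_eq_of_natDegree_le dp.1 le_rfl, dp.2, dq.2, coeff_natDegree, coeff_natDegree]
      have hne : (q.natDegree : ℝ) - p.natDegree ≠ 0 :=
        sub_ne_zero.mpr fun h' => h rfl (Nat.cast_injective h'.symm)
      have : p.leadingCoeff * (q.natDegree * q.leadingCoeff)
          - p.natDegree * p.leadingCoeff * q.leadingCoeff
          = (q.natDegree - p.natDegree) * (p.leadingCoeff * q.leadingCoeff) := by ring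
      rw [this]
      exact mul_ne_zero hβ (mul_ne_zero hne hlc)
    have hne : quasiWronskian β β p q ≠ 0 := fun h0 => hc (by simp [h0])
    refine ⟨hne, ?_⟩
    rw [← natDegree_X_mul hne]
    refine le_antisymm ?_ (le_natDegree_of_ne_zero hc)
    rw [e]
    refine (natDegree_C_mul_le _ _).trans ((natDegree_sub_le_of_le ?_ ?_).trans (max_self _).le)
    · exact natDegree_mul_le.trans (by have := dq.1; omega)
    · exact natDegree_mul_le.trans (by have := dp.1; omega)
  · have hc : (quasiWronskian β γ p q).coeff (p.natDegree + q.natDegree) ≠ 0 := by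
      have e : quasiWronskian β γ p q = C γ * (p * taylor 1 q) - C β * (taylor 1 p * q) := by
        rw [quasiWronskian]; ring
      rw [e, coeff_sub, coeff_C_mul, coeff_C_mul,
        coeff_mul_add_eq_of_natDegree_le le_rfl (natDegree_taylor q 1).le,
        coeff_mul_add_eq_of_natDegree_le (natDegree_taylor p 1).le le_rfl,
        coeff_taylor_natDegree, coeff_taylor_natDegree, coeff_natDegree, coeff_natDegree, ← sub_mul]
      exact mul_ne_zero (sub_ne_zero.mpr (Ne.symm hβγ)) hlc
    refine ⟨fun h0 => hc (by simp [h0]), ?_⟩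
    refine le_antisymm ?_ (le_natDegree_of_ne_zero hc)
    rw [add_zero, quasiWronskian, mul_assoc, mul_assoc]
    refine (natDegree_sub_le_of_le ((natDegree_C_mul_le _ _).trans natDegree_mul_le)
      ((natDegree_C_mul_le _ _).trans natDegree_mul_le)).trans (le_of_eq ?_)
    rw [natDegree_taylor, natDegree_taylor, max_self]

/-- A difference operator of order less than `k` that annihilates `k` quasi-polynomials with
distinct pairs (base, degree) is zero. Summation by parts factors out of the operator the first
order operator annihilating the first of them, which sends each of the others to a
quasi-polynomial again, the pairs remaining distinct. -/
theorem eq_zero_of_sum_mul_quasiPoly_eq_zero (k : ℕ) (β : Fin k → ℝ) (p : Fin k → ℝ[X])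
    (hβ : ∀ i, β i ≠ 0) (hp : ∀ i, p i ≠ 0)
    (hinj : Function.Injective fun i => (β i, (p i).natDegree)) (y : ℕ → RatFunc ℝ)
    (hy : ∀ i, ∑ l ∈ Finset.range k,
      y l * algebraMap ℝ[X] (RatFunc ℝ) (quasiPoly (β i) (p i) l) = 0) :
    ∀ l < k, y l = 0 := by
  induction k generalizing y with
  | zero => intro l hl; omega
  | succ k ih =>
    let F : ℕ → RatFunc ℝ := fun l => algebraMap ℝ[X] (RatFunc ℝ) (quasiPoly (β 0) (p 0) l)
    have hF : ∀ l, F l ≠ 0 := by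
      intro l
      refine RatFunc.algebraMap_ne_zero ?_
      rw [quasiPoly, ← taylor_apply]
      exact mul_ne_zero (C_ne_zero.mpr (pow_ne_zero _ (hβ 0)))
        (fun h => hp 0 ((taylor_eq_zero _ _).mp h))
    -- Partial sums for the summation by parts; `Y (k + 1) = 0` is the hypothesis on `p 0`.
    let Y : ℕ → RatFunc ℝ := fun l => ∑ j ∈ Finset.range l, y j * F j
    have hYk : Y (k + 1) = 0 := hy 0
    have hz := ih (fun i => β 0 * β i.succ)
      (fun i => quasiWronskian (β 0) (β i.succ) (p 0) (p i.succ))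
      (fun i => mul_ne_zero (hβ 0) (hβ _)) ?_ ?_ (fun l => Y (l + 1) / (F l * F (l + 1))) ?_
    · have hY : ∀ l ≤ k + 1, Y l = 0 := by
        intro l hl
        rcases Nat.eq_zero_or_pos l with rfl | hpos
        · simp [Y]
        · rcases Nat.lt_or_ge l (k + 1) with h | h
          · have := hz (l - 1) (by omega)
            rw [show l - 1 + 1 = l by omega] at this
            exact (div_eq_zero_iff.mp this).resolve_right (mul_ne_zero (hF _) (hF _))
          · rwa [show l = k + 1 by omega]
      intro l hl
      have h1 : Y (l + 1) = Y l + y l * F l := Finset.sum_range_succ _ _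
      rw [hY _ hl.le, hY _ hl, zero_add] at h1
      exact (mul_eq_zero.mp h1.symm).resolve_right (hF l)
    · intro i
      refine (natDegree_quasiWronskian (hp 0) (hp _) (fun h h' => ?_) (hβ 0)).1
      exact Fin.succ_ne_zero i (hinj (Prod.ext h h')).symm
    · intro i j hij
      have hw : ∀ i : Fin k, (quasiWronskian (β 0) (β i.succ) (p 0) (p i.succ)).natDegree
          + (if β 0 = β i.succ then 1 else 0) = (p 0).natDegree + (p i.succ).natDegree := fun i =>
        (natDegree_quasiWronskian (hp 0) (hp i.succ)
          (fun h h' => Fin.succ_ne_zero i (hinj (Prod.ext h h')).symm) (hβ 0)).2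
      have hi := hw i
      obtain ⟨h1, h2⟩ := Prod.ext_iff.mp hij
      have h3 : β i.succ = β j.succ := mul_left_cancel₀ (hβ 0) h1
      simp only at h2
      rw [h2, h3, hw j] at hi
      exact Fin.succ_injective _ (hinj (Prod.ext h3 (by simpa using hi.symm)))
    · intro i
      let G : ℕ → RatFunc ℝ :=
        fun l => algebraMap ℝ[X] (RatFunc ℝ) (quasiPoly (β i.succ) (p i.succ) l)
      have hG : ∀ l, algebraMap ℝ[X] (RatFunc ℝ)
          (quasiPoly (β 0 * β i.succ) (quasiWronskian (β 0) (β i.succ) (p 0) (p i.succ)) l)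
          = F l * G (l + 1) - F (l + 1) * G l := by
        intro l
        rw [← quasiPoly_wronskian, map_sub, map_mul, map_mul]
      have hparts : ∀ m, ∑ l ∈ Finset.range m, Y (l + 1) / (F l * F (l + 1))
            * (F l * G (l + 1) - F (l + 1) * G l)
          = Y (m + 1) * (G m / F m) - ∑ l ∈ Finset.range (m + 1), y l * G l := by
        intro m
        induction m with
        | zero =>
          have := hF 0
          simp [Y]
          field_simp
          simp
        | succ m ihm =>
          have h1 : Y (m + 1 + 1) = Y (m + 1) + y (m + 1) * F (m + 1) := Finset.sum_range_succ _ _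
          rw [Finset.sum_range_succ, ihm, Finset.sum_range_succ _ (m + 1), h1]
          have := hF m
          have := hF (m + 1)
          field_simp
          ring
      simp only [hG]
      rw [hparts k, hYk, zero_mul, zero_sub, neg_eq_zero]
      exact hy i.succ

/-- Casorati determinants of quasi-polynomials with distinct pairs (base, degree) do not
vanish. -/
theorem det_quasiPoly_ne_zero {k : ℕ} (β : Fin k → ℝ) (p : Fin k → ℝ[X])
    (hβ : ∀ i, β i ≠ 0) (hp : ∀ i, p i ≠ 0)
    (hinj : Function.Injective fun i => (β i, (p i).natDegree)) :
    Matrix.det (Matrix.of fun i l : Fin k => quasiPoly (β i) (p i) l) ≠ 0 := by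
  intro h0
  have h1 : Matrix.det ((algebraMap ℝ[X] (RatFunc ℝ)).mapMatrix
      (Matrix.of fun i l : Fin k => quasiPoly (β i) (p i) l)) = 0 := by
    rw [← RingHom.map_det, h0, map_zero]
  obtain ⟨v, hv, hv0⟩ := Matrix.exists_mulVec_eq_zero_iff.mpr h1
  refine hv (funext fun l => ?_)
  have := eq_zero_of_sum_mul_quasiPoly_eq_zero k β p hβ hp hinj
    (fun l => if h : l < k then v ⟨l, h⟩ else 0) (fun i => ?_) l l.2
  · simpa using this
  · have := congrFun hv0 i
    simp only [Matrix.mulVec, dotProduct, RingHom.mapMatrix_apply, Matrix.map_apply,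
      Matrix.of_apply, Pi.zero_apply] at this
    rw [Finset.sum_range, ← this]
    exact Finset.sum_congr rfl fun l _ => by simp [mul_comm]

/-! ### The Crum transformation of a second order difference operator -/

section Crum

variable {K : Type*} [Field K]

/-- The Casorati determinant of the sequences `r i`, with columns at `j, j + 1, …, j + k - 1`. -/
def casorati {k : ℕ} (r : Fin k → ℕ → K) (j : ℕ) : K :=
  Matrix.det (Matrix.of fun i l : Fin k => r i (j + l))

/-- The Casorati determinant with its last column moved one step further: columns at
`j, …, j + k - 2, j + k`. -/
def casoratiSkip {k : ℕ} (r : Fin k → ℕ → K) (j : ℕ) : K :=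
  Matrix.det (Matrix.of fun i l : Fin k => r i (j + if (l : ℕ) + 1 = k then k else l))

theorem casorati_cons_self {k : ℕ} (r : Fin k → ℕ → K) (i : Fin k) (j : ℕ) :
    casorati (Fin.cons (r i) r : Fin (k + 1) → ℕ → K) j = 0 := by
  refine Matrix.det_zero_of_row_eq (i := 0) (j := i.succ) (Fin.succ_ne_zero i).symm ?_
  ext l
  simp

/-- Expansion of a Casorati determinant along its first row: a difference operator of order `k`
whose two leading coefficients and whose last coefficient are, up to sign,
`casorati r j`, `casoratiSkip r j` and `casorati r (j + 1)`. -/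
theorem exists_casorati_cons_eq_sum {n : ℕ} (r : Fin (n + 1) → ℕ → K) (j : ℕ) :
    ∃ m : ℕ → K, m 0 = casorati r (j + 1) ∧ m n = (-1) ^ n * casoratiSkip r j ∧
      m (n + 1) = (-1) ^ (n + 1) * casorati r j ∧
      ∀ s : ℕ → K, casorati (Fin.cons s r : Fin (n + 2) → ℕ → K) j
        = ∑ l ∈ Finset.range (n + 2), m l * s (l + j) := by
  let M : Fin (n + 2) → K := fun l =>
    (-1) ^ (l : ℕ) * Matrix.det (Matrix.of fun i p : Fin (n + 1) => r i (j + (l.succAbove p : ℕ)))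
  refine ⟨fun l => if h : l < n + 2 then M ⟨l, h⟩ else 0, ?_, ?_, ?_, fun s => ?_⟩
  · simp only [M, casorati]
    simp [add_assoc, add_comm 1]
  · simp only [M, casoratiSkip]
    rw [dif_pos (by omega)]
    congr 3
    ext i p
    congr 2
    have hp := p.2
    by_cases h : (p : ℕ) = n
    · rw [Fin.succAbove_of_le_castSucc _ _ (by simp [Fin.le_def, h])]
      simp [h]
    · rw [Fin.succAbove_of_castSucc_lt _ _ (by simp [Fin.lt_def]; omega)]
      simp [h]
  · simp only [M, casorati]
    rw [dif_pos (by omega)]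
    have : (⟨n + 1, by omega⟩ : Fin (n + 2)) = Fin.last (n + 1) := rfl
    rw [this]
    simp
  · rw [casorati, Matrix.det_succ_row_zero, Finset.sum_range]
    refine Finset.sum_congr rfl fun l _ => ?_
    simp only [M, l.2, dif_pos, Matrix.of_apply, Fin.cons_zero, add_comm j]
    have : (Matrix.of fun (i l : Fin (n + 2)) =>
          (Fin.cons s r : Fin (n + 2) → ℕ → K) i (l + j)).submatrix Fin.succ l.succAbove
        = Matrix.of fun i p : Fin (n + 1) => r i ((l.succAbove p : ℕ) + j) := by
      ext i p
      simp
    rw [this]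
    ring

/-- The Crum transformation. If all `r i` and `s` are eigensequences of one second order
difference operator, then the Casorati determinants of `s, r` satisfy a second order equation
with the eigenvalue of `s`. The difference of the two sides, seen as a linear form in an arbitrary
sequence `s`, has no terms at the positions `0`, `k + 1`, `k + 2`, and it vanishes at each of the
`k` sequences `r i`, whose Casorati determinant is nonzero; hence it is zero. -/
theorem casorati_crum {k : ℕ} (hk : 0 < k) (r : Fin k → ℕ → K) (s : ℕ → K) (A B E : ℕ → K)
    (ev : Fin k → K) (μ : K)
    (hr : ∀ i j, A j * r i j + B j * r i (j + 1) + E j * r i (j + 2) = ev i * r i (j + 1))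
    (hs : ∀ j, A j * s j + B j * s (j + 1) + E j * s (j + 2) = μ * s (j + 1))
    (h₁ : casorati r 1 ≠ 0) (h₂ : casorati r 2 ≠ 0) :
    A 0 * casorati r 2 / casorati r 1 * casorati (Fin.cons s r : Fin (k + 1) → ℕ → K) 0
      + (B k + E k * casoratiSkip r 2 / casorati r 2
          - E (k - 1) * casoratiSkip r 1 / casorati r 1)
        * casorati (Fin.cons s r : Fin (k + 1) → ℕ → K) 1
      + E k * casorati r 1 / casorati r 2
        * casorati (Fin.cons s r : Fin (k + 1) → ℕ → K) 2
    = μ * casorati (Fin.cons s r : Fin (k + 1) → ℕ → K) 1 := by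
  obtain ⟨n, rfl⟩ : ∃ n, k = n + 1 := ⟨k - 1, by omega⟩
  rw [Nat.add_sub_cancel]
  obtain ⟨m₀, hm₀, -, -, e₀⟩ := exists_casorati_cons_eq_sum r 0
  obtain ⟨m₁, hm₁, hm₁', hm₁'', e₁⟩ := exists_casorati_cons_eq_sum r 1
  obtain ⟨m₂, -, hm₂', hm₂'', e₂⟩ := exists_casorati_cons_eq_sum r 2
  rw [zero_add] at hm₀
  set g₀ := A 0 * casorati r 2 / casorati r 1 with hg₀
  set g₁ := B (n + 1) + E (n + 1) * casoratiSkip r 2 / casorati r 2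
          - E n * casoratiSkip r 1 / casorati r 1 with hg₁
  set g₂ := E (n + 1) * casorati r 1 / casorati r 2 with hg₂
  -- The coefficient of `q (l + 1)` that remains in the commutator, for `l ≤ n`.
  let t : ℕ → K := fun l => g₀ * m₀ (l + 1) + g₁ * m₁ l - m₁ (l + 1) * A (l + 1) - m₁ l * B l
    + l.casesOn 0 (fun l => g₂ * m₂ l - m₁ l * E l)
  -- The commutator of the two operators, as a linear form in the sequence.
  have key : ∀ q : ℕ → K,
      g₀ * casorati (Fin.cons q r : Fin (n + 2) → ℕ → K) 0
      + g₁ * casorati (Fin.cons q r : Fin (n + 2) → ℕ → K) 1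
      + g₂ * casorati (Fin.cons q r : Fin (n + 2) → ℕ → K) 2
      - ∑ l ∈ Finset.range (n + 2), m₁ l * (A l * q l + B l * q (l + 1) + E l * q (l + 2))
      = ∑ l ∈ Finset.range (n + 1), t l * q (l + 1) := by
    intro q
    rw [e₀, e₁, e₂]
    have s₀ : ∑ l ∈ Finset.range (n + 2), m₀ l * q (l + 0)
        = ∑ l ∈ Finset.range (n + 1), m₀ (l + 1) * q (l + 1) + m₀ 0 * q 0 := by
      rw [Finset.sum_range_succ']
    have s₁ : ∑ l ∈ Finset.range (n + 2), m₁ l * q (l + 1)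
        = ∑ l ∈ Finset.range (n + 1), m₁ l * q (l + 1) + m₁ (n + 1) * q (n + 2) := by
      rw [Finset.sum_range_succ]
    have s₂ : ∑ l ∈ Finset.range (n + 2), m₂ l * q (l + 2)
        = ∑ l ∈ Finset.range n, m₂ l * q (l + 2) + m₂ n * q (n + 2)
          + m₂ (n + 1) * q (n + 3) := by
      rw [Finset.sum_range_succ, Finset.sum_range_succ]
    have s₃ : ∑ l ∈ Finset.range (n + 2), m₁ l * (A l * q l + B l * q (l + 1) + E l * q (l + 2))
        = (∑ l ∈ Finset.range (n + 1), m₁ (l + 1) * A (l + 1) * q (l + 1) + m₁ 0 * A 0 * q 0)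
          + (∑ l ∈ Finset.range (n + 1), m₁ l * B l * q (l + 1)
            + m₁ (n + 1) * B (n + 1) * q (n + 2))
          + (∑ l ∈ Finset.range n, m₁ l * E l * q (l + 2) + m₁ n * E n * q (n + 2)
            + m₁ (n + 1) * E (n + 1) * q (n + 3)) := by
      rw [← Finset.sum_range_succ' (fun l => m₁ l * A l * q l),
        ← Finset.sum_range_succ (fun l => m₁ l * B l * q (l + 1)),
        ← Finset.sum_range_succ (fun l => m₁ l * E l * q (l + 2)),
        ← Finset.sum_range_succ (fun l => m₁ l * E l * q (l + 2)),
        ← Finset.sum_add_distrib, ← Finset.sum_add_distrib]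
      exact Finset.sum_congr rfl fun l _ => by ring
    have st : ∑ l ∈ Finset.range (n + 1), t l * q (l + 1)
        = g₀ * ∑ l ∈ Finset.range (n + 1), m₀ (l + 1) * q (l + 1)
          + g₁ * ∑ l ∈ Finset.range (n + 1), m₁ l * q (l + 1)
          - ∑ l ∈ Finset.range (n + 1), m₁ (l + 1) * A (l + 1) * q (l + 1)
          - ∑ l ∈ Finset.range (n + 1), m₁ l * B l * q (l + 1)
          + (g₂ * ∑ l ∈ Finset.range n, m₂ l * q (l + 2)
            - ∑ l ∈ Finset.range n, m₁ l * E l * q (l + 2)) := by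
      have : g₂ * ∑ l ∈ Finset.range n, m₂ l * q (l + 2)
            - ∑ l ∈ Finset.range n, m₁ l * E l * q (l + 2)
          = ∑ l ∈ Finset.range (n + 1),
              (l.casesOn 0 (fun l => g₂ * m₂ l - m₁ l * E l) : K) * q (l + 1) := by
        rw [Finset.sum_range_succ', Finset.mul_sum, ← Finset.sum_sub_distrib]
        refine (add_zero _).symm.trans (congrArg₂ _ ?_ (zero_mul _).symm)
        exact Finset.sum_congr rfl fun l _ => by ring
      rw [this, Finset.mul_sum, Finset.mul_sum, ← Finset.sum_add_distrib,
        ← Finset.sum_sub_distrib, ← Finset.sum_sub_distrib, ← Finset.sum_add_distrib]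
      exact Finset.sum_congr rfl fun l _ => by simp only [t]; ring
    -- The three extreme coefficients cancel.
    have c₀ : g₀ * m₀ 0 = m₁ 0 * A 0 := by
      rw [hm₀, hm₁, hg₀]
      field_simp
    have c₁ : g₁ * m₁ (n + 1) + g₂ * m₂ n = m₁ (n + 1) * B (n + 1) + m₁ n * E n := by
      rw [hm₁', hm₁'', hm₂', hg₁, hg₂]
      field_simp
      ring
    have c₂ : g₂ * m₂ (n + 1) = m₁ (n + 1) * E (n + 1) := by
      rw [hm₁'', hm₂'', hg₂]
      field_simp
    rw [s₀, s₁, s₂, s₃, st]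
    linear_combination q 0 * c₀ + q (n + 2) * c₁ + q (n + 3) * c₂
  have ht : (fun l : Fin (n + 1) => t l) = 0 := by
    refine Matrix.eq_zero_of_mulVec_eq_zero h₁ (funext fun i => ?_)
    have h := key (r i)
    rw [casorati_cons_self, casorati_cons_self, casorati_cons_self] at h
    have h' : ∑ l ∈ Finset.range (n + 2),
        m₁ l * (A l * r i l + B l * r i (l + 1) + E l * r i (l + 2)) = 0 := by
      have e := e₁ (r i)
      rw [casorati_cons_self] at e
      rw [← mul_zero (ev i), e, Finset.mul_sum]
      exact Finset.sum_congr rfl fun l _ => by rw [hr]; ring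
    rw [h', Finset.sum_range] at h
    simp only [Matrix.mulVec, dotProduct, Matrix.of_apply, Pi.zero_apply]
    rw [eq_comm]
    simpa [mul_comm, add_comm] using h
  have h := key s
  have ht' : ∑ l ∈ Finset.range (n + 1), t l * s (l + 1) = 0 := by
    rw [Finset.sum_range]
    exact Finset.sum_eq_zero fun l _ => by rw [show t l = 0 from congrFun ht l, zero_mul]
  have hD : ∑ l ∈ Finset.range (n + 2), m₁ l * (A l * s l + B l * s (l + 1) + E l * s (l + 2))
      = μ * casorati (Fin.cons s r : Fin (n + 2) → ℕ → K) 1 := by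
    rw [e₁, Finset.mul_sum]
    exact Finset.sum_congr rfl fun l _ => by rw [hs]; ring
  rw [ht', hD] at h
  exact sub_eq_zero.mp h

end Crum

/-! ### Shifts of rational functions and of determinants -/

theorem shift_algebraMap (r : ℝ) (p : ℝ[X]) :
    shift r (algebraMap ℝ[X] (RatFunc ℝ) p)
      = algebraMap ℝ[X] (RatFunc ℝ) (p.comp (X + C r)) := by
  simpa using shift_div r p 1

theorem shift_C (r s : ℝ) : shift r (RatFunc.C s) = RatFunc.C s := by
  rw [← RatFunc.algebraMap_C, shift_algebraMap, C_comp]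

theorem shift_X (r : ℝ) : shift r RatFunc.X = RatFunc.X + RatFunc.C r := by
  rw [← RatFunc.algebraMap_X, shift_algebraMap, X_comp, map_add, RatFunc.algebraMap_C]

theorem shift_shift (r s : ℝ) (f : RatFunc ℝ) : shift r (shift s f) = shift (r + s) f := by
  induction f using RatFunc.induction_on with
  | f p q hq =>
    have h : ∀ p : ℝ[X], (p.comp (X + C s)).comp (X + C r) = p.comp (X + C (r + s)) := fun p => by
      rw [comp_assoc]
      congr 1
      simp [add_assoc]
    rw [shift_div, shift_div, shift_div, h, h]

theorem shift_zero (f : RatFunc ℝ) : shift 0 f = f := by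
  induction f using RatFunc.induction_on with
  | f p q hq => rw [shift_div]; simp

theorem quasiPoly_add (β : ℝ) (p : ℝ[X]) (j l : ℕ) :
    quasiPoly β p (j + l) = C (β ^ j) * (quasiPoly β p l).comp (X + C (j : ℝ)) := by
  have h : (p.comp (X + C (l : ℝ))).comp (X + C (j : ℝ)) = p.comp (X + C ((j + l : ℕ) : ℝ)) := by
    rw [comp_assoc]
    congr 1
    simp [add_assoc]
  rw [quasiPoly, quasiPoly, mul_comp, C_comp, h, pow_add, C_mul, mul_assoc]

/-- Moving all columns of a determinant of quasi-polynomials by `j` shifts the determinant, up to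
the `j`-th power of the product of the bases. -/
theorem det_quasiPoly_add {k : ℕ} (β : Fin k → ℝ) (p : Fin k → ℝ[X]) (κ : Fin k → ℕ) (j : ℕ) :
    Matrix.det (Matrix.of fun i l : Fin k =>
        algebraMap ℝ[X] (RatFunc ℝ) (quasiPoly (β i) (p i) (j + κ l)))
      = RatFunc.C (∏ i, β i) ^ j * shift j (algebraMap ℝ[X] (RatFunc ℝ)
          (Matrix.det (Matrix.of fun i l : Fin k => quasiPoly (β i) (p i) (κ l)))) := by
  let φ : ℝ[X] →+* RatFunc ℝ := (shift j : RatFunc ℝ →+* RatFunc ℝ).comp (algebraMap ℝ[X] _)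
  have h : (Matrix.of fun i l : Fin k =>
        algebraMap ℝ[X] (RatFunc ℝ) (quasiPoly (β i) (p i) (j + κ l)))
      = Matrix.of fun i l : Fin k => RatFunc.C (β i ^ j) *
          (φ.mapMatrix (Matrix.of fun i l : Fin k => quasiPoly (β i) (p i) (κ l))) i l := by
    ext i l
    simp only [Matrix.of_apply, RingHom.mapMatrix_apply, Matrix.map_apply, φ, RingHom.comp_apply,
      RingHom.coe_coe, shift_algebraMap, quasiPoly_add, map_mul, RatFunc.algebraMap_C]
  rw [h, Matrix.det_mul_column, ← RingHom.map_det]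
  simp [φ, Finset.prod_pow, map_prod]

/-! ### The determinants of the exceptional Meixner polynomials -/

/-- The bases of the quasi-polynomials in the rows of the determinants. -/
noncomputable def rowBase (a : ℝ) (F₁ F₂ : Finset ℕ) : Fin (F₁.card + F₂.card) → ℝ :=
  Fin.append (fun _ => 1) (fun _ => a⁻¹)

/-- The polynomial factors of the quasi-polynomials in the rows of the determinants. -/
noncomputable def rowPoly (a c : ℝ) (F₁ F₂ : Finset ℕ) : Fin (F₁.card + F₂.card) → ℝ[X] :=
  Fin.append (fun i => meixner a c (F₁.orderEmbOfFin rfl i))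
    (fun i => meixner (1 / a) c (F₂.orderEmbOfFin rfl i))

/-- The eigenvalues of the rows: the function `a ^ (-x) m_f^{1/a,c}(x)` is an eigenfunction of the
Meixner operator with parameter `a`, with eigenvalue `-(f + c)`. -/
noncomputable def rowEigenvalue (c : ℝ) (F₁ F₂ : Finset ℕ) : Fin (F₁.card + F₂.card) → ℝ :=
  Fin.append (fun i => (F₁.orderEmbOfFin rfl i : ℝ)) (fun i => -((F₂.orderEmbOfFin rfl i : ℝ) + c))

theorem rows_eq_quasiPoly (a c : ℝ) (F₁ F₂ : Finset ℕ) (i : Fin (F₁.card + F₂.card)) (l : ℕ) :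
    rows a c F₁ F₂ i l = quasiPoly (rowBase a F₁ F₂ i) (rowPoly a c F₁ F₂ i) l := by
  refine Fin.addCases (fun i => ?_) (fun i => ?_) i <;>
    simp [rows, rowBase, rowPoly, quasiPoly, meixnerShift]

theorem cons_rows_eq_quasiPoly (a c : ℝ) (F₁ F₂ : Finset ℕ) (m : ℕ)
    (i : Fin (F₁.card + F₂.card + 1)) (l : ℕ) :
    (Fin.cons (fun l => meixnerShift a c m l) (rows a c F₁ F₂) :
        Fin (F₁.card + F₂.card + 1) → ℕ → ℝ[X]) i l
      = quasiPoly ((Fin.cons 1 (rowBase a F₁ F₂) : Fin (F₁.card + F₂.card + 1) → ℝ) i)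
        ((Fin.cons (meixner a c m) (rowPoly a c F₁ F₂) :
          Fin (F₁.card + F₂.card + 1) → ℝ[X]) i) l := by
  refine Fin.cases ?_ (fun i => ?_) i
  · simp [quasiPoly, meixnerShift]
  · simp [rows_eq_quasiPoly]

theorem rowBase_ne_zero {a : ℝ} (ha₀ : a ≠ 0) (F₁ F₂ : Finset ℕ) (i : Fin (F₁.card + F₂.card)) :
    rowBase a F₁ F₂ i ≠ 0 := by
  refine Fin.addCases (fun i => ?_) (fun i => ?_) i <;> simp [rowBase, ha₀]

theorem rowPoly_ne_zero {a : ℝ} (c : ℝ) (ha₀ : a ≠ 0) (ha₁ : a ≠ 1) (F₁ F₂ : Finset ℕ)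
    (i : Fin (F₁.card + F₂.card)) : rowPoly a c F₁ F₂ i ≠ 0 := by
  have h0 : 1 / a ≠ 0 := one_div_ne_zero ha₀
  have h1 : 1 / a ≠ 1 := by simpa using ha₁
  refine Fin.addCases (fun i => ?_) (fun i => ?_) i
  · simpa [rowPoly] using (natDegree_meixner c ha₀ ha₁ _).1
  · simpa [rowPoly] using (natDegree_meixner c h0 h1 (F₂.orderEmbOfFin rfl i)).1

/-- The rows, together with the row of `m ∉ F₁`, have distinct pairs (base, degree): this is where
`a ≠ 1` and the exclusion of `u_F + F₁` from `σ_F` enter. -/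
theorem injective_cons_row {a : ℝ} (c : ℝ) (ha₀ : a ≠ 0) (ha₁ : a ≠ 1) (F₁ F₂ : Finset ℕ) {m : ℕ}
    (hm : m ∉ F₁) :
    Function.Injective fun i : Fin (F₁.card + F₂.card + 1) =>
      ((Fin.cons 1 (rowBase a F₁ F₂) : Fin (F₁.card + F₂.card + 1) → ℝ) i,
        ((Fin.cons (meixner a c m) (rowPoly a c F₁ F₂) :
          Fin (F₁.card + F₂.card + 1) → ℝ[X]) i).natDegree) := by
  have h0 : a⁻¹ ≠ 0 := inv_ne_zero ha₀
  have h1 : a⁻¹ ≠ 1 := by simpa using ha₁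
  have hd := fun m => (natDegree_meixner c ha₀ ha₁ m).2
  have hd' := fun m => (natDegree_meixner c h0 h1 m).2
  have hmem : ∀ i, F₁.orderEmbOfFin rfl i ≠ m := fun i h =>
    hm (h ▸ F₁.orderEmbOfFin_mem rfl i)
  intro i j
  refine Fin.cases ?_ (fun i => ?_) i <;> refine Fin.cases ?_ (fun j => ?_) j
  · simp
  · refine Fin.addCases (fun j => ?_) (fun j => ?_) j
    · simp [rowBase, rowPoly, hd, (hmem j).symm]
    · simp [rowBase, h1.symm]
  · refine Fin.addCases (fun j => ?_) (fun j => ?_) i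
    · simp [rowBase, rowPoly, hd, hmem j]
    · simp [rowBase, h1]
  · refine Fin.addCases (fun i => ?_) (fun i => ?_) i <;>
      refine Fin.addCases (fun j => ?_) (fun j => ?_) j
    · simp [rowBase, rowPoly, hd]
    · simp [rowBase, h1.symm]
    · simp [rowBase, h1]
    · simp [rowBase, rowPoly, hd']

theorem Omega_ne_zero {a : ℝ} (c : ℝ) (ha₀ : a ≠ 0) (ha₁ : a ≠ 1) (F₁ F₂ : Finset ℕ) :
    Omega a c F₁ F₂ ≠ 0 := by
  obtain ⟨m, hm⟩ := Infinite.exists_notMem_finset F₁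
  have hinj := (injective_cons_row c ha₀ ha₁ F₁ F₂ hm).comp (Fin.succ_injective _)
  have h := det_quasiPoly_ne_zero _ _ (rowBase_ne_zero ha₀ F₁ F₂)
    (rowPoly_ne_zero c ha₀ ha₁ F₁ F₂) (by simpa [Function.comp_def] using hinj)
  simpa only [Omega, rows_eq_quasiPoly] using h

theorem excMeixner_ne_zero {a : ℝ} (c : ℝ) (ha₀ : a ≠ 0) (ha₁ : a ≠ 1) (F₁ F₂ : Finset ℕ) {n : ℕ}
    (hn : n - u F₁ F₂ ∉ F₁) : excMeixner a c F₁ F₂ n ≠ 0 := by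
  simp only [excMeixner, cons_rows_eq_quasiPoly]
  refine det_quasiPoly_ne_zero _ _ (fun i => ?_) (fun i => ?_)
    (injective_cons_row c ha₀ ha₁ F₁ F₂ hn)
  · refine Fin.cases ?_ (fun i => ?_) i
    · simp
    · simpa using rowBase_ne_zero ha₀ F₁ F₂ i
  · refine Fin.cases ?_ (fun i => ?_) i
    · simpa using (natDegree_meixner c ha₀ ha₁ _).1
    · simpa using rowPoly_ne_zero c ha₀ ha₁ F₁ F₂ i

theorem meixnerShift_diff {a : ℝ} (c : ℝ) (ha₀ : a ≠ 0) (n j : ℕ) :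
    (X + C ((j : ℝ) + 1)) * meixnerShift a c n j
      - (C (1 + a) * (X + C ((j : ℝ) + 1)) + C (a * c)) * meixnerShift a c n (j + 1)
      + C a * (X + C ((j : ℝ) + 1) + C c) * meixnerShift a c n (j + 2)
    = C (a - 1) * C (n : ℝ) * meixnerShift a c n (j + 1) := by
  have h := meixner_diff c ha₀ n (X + C ((j : ℝ) + 1))
  have e₁ : (X + C ((j : ℝ) + 1) - 1 : ℝ[X]) = X + C (j : ℝ) := by
    rw [C_add, C_1]; ring
  have e₂ : (X + C ((j : ℝ) + 1) + 1 : ℝ[X]) = X + C ((j + 2 : ℕ) : ℝ) := by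
    push_cast
    rw [C_add, C_add, C_1, show (C 2 : ℝ[X]) = 2 from rfl]; ring
  rw [e₁, e₂] at h
  simpa [meixnerShift] using h

/-- All rows are eigensequences of the Meixner operator with parameter `a`, multiplied by
`a - 1`. -/
theorem rows_diff {a : ℝ} (c : ℝ) (ha₀ : a ≠ 0) (F₁ F₂ : Finset ℕ)
    (i : Fin (F₁.card + F₂.card)) (j : ℕ) :
    (X + C ((j : ℝ) + 1)) * rows a c F₁ F₂ i j
      - (C (1 + a) * (X + C ((j : ℝ) + 1)) + C (a * c)) * rows a c F₁ F₂ i (j + 1)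
      + C a * (X + C ((j : ℝ) + 1) + C c) * rows a c F₁ F₂ i (j + 2)
    = C (a - 1) * C (rowEigenvalue c F₁ F₂ i) * rows a c F₁ F₂ i (j + 1) := by
  refine Fin.addCases (fun i => ?_) (fun i => ?_) i
  · simpa [rows, rowEigenvalue] using meixnerShift_diff c ha₀ (F₁.orderEmbOfFin rfl i) j
  · have h := meixnerShift_diff c (one_div_ne_zero ha₀) (F₂.orderEmbOfFin rfl i) j
    simp only [rows, rowEigenvalue, Fin.append_right]
    generalize meixnerShift (1 / a) c (F₂.orderEmbOfFin rfl i) j = y₀ at *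
    generalize meixnerShift (1 / a) c (F₂.orderEmbOfFin rfl i) (j + 1) = y₁ at *
    generalize meixnerShift (1 / a) c (F₂.orderEmbOfFin rfl i) (j + 2) = y₂ at *
    have hC : (C a : ℝ[X]) * C a⁻¹ = 1 := by rw [← C_mul, mul_inv_cancel₀ ha₀, C_1]
    simp only [pow_succ, mul_inv, C_mul, one_div, C_add, C_sub, C_neg, C_1] at h ⊢
    generalize (C a⁻¹ : ℝ[X]) = t at *
    generalize (C a : ℝ[X]) = s at *
    generalize (C (a ^ j)⁻¹ : ℝ[X]) = w at *
    generalize (C c : ℝ[X]) = d at *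
    generalize (C (j : ℝ) : ℝ[X]) = z at *
    generalize (C ((F₂.orderEmbOfFin rfl i : ℕ) : ℝ) : ℝ[X]) = f at *
    linear_combination w * h + w * (-(X + z + 1) * y₁ + (X + z + 1 + d) * t * y₂ - d * y₁
      + (f + d) * y₁) * hC

/-- The polynomials are eigenfunctions: the Crum transformation applied to the rows, which gives
the equation shifted by one. -/
theorem D_excMeixner {a : ℝ} (c : ℝ) (ha₀ : a ≠ 0) (ha₁ : a ≠ 1) (F₁ F₂ : Finset ℕ)
    (hk : 0 < F₁.card + F₂.card) {n : ℕ} (hn : u F₁ F₂ ≤ n) :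
    D a c F₁ F₂ (algebraMap ℝ[X] (RatFunc ℝ) (excMeixner a c F₁ F₂ n))
      = (n : ℝ) • algebraMap ℝ[X] (RatFunc ℝ) (excMeixner a c F₁ F₂ n) := by
  have hΩ := Omega_ne_zero c ha₀ ha₁ F₁ F₂
  set m := n - u F₁ F₂ with hm
  have hnm : (n : ℝ) = u F₁ F₂ + m := by rw [hm, Nat.cast_sub hn]; ring
  let r : Fin (F₁.card + F₂.card) → ℕ → RatFunc ℝ :=
    fun i l => algebraMap ℝ[X] (RatFunc ℝ) (rows a c F₁ F₂ i l)
  let s : ℕ → RatFunc ℝ := fun l => algebraMap ℝ[X] (RatFunc ℝ) (meixnerShift a c m l)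
  have ha1 : RatFunc.C (a - 1) ≠ 0 := by
    rw [Ne, map_eq_zero]; exact sub_ne_zero.mpr ha₁
  -- The determinants at position `j` carry the factor `b ^ j`, which cancels in the end.
  set b := RatFunc.C (∏ i, rowBase a F₁ F₂ i) with hb
  have hb0 : b ≠ 0 := by
    rw [hb, Ne, map_eq_zero]
    exact Finset.prod_ne_zero_iff.mpr fun i _ => rowBase_ne_zero ha₀ F₁ F₂ i
  have hcas : ∀ j : ℕ, casorati r j = b ^ j * shift j (OmegaR a c F₁ F₂) := by
    intro j
    simp only [casorati, r, OmegaR, Omega, rows_eq_quasiPoly]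
    exact det_quasiPoly_add _ _ (fun l => (l : ℕ)) j
  have hskip : ∀ j : ℕ, casoratiSkip r j = b ^ j * shift j (LambdaR a c F₁ F₂) := by
    intro j
    simp only [casoratiSkip, r, LambdaR, Lambda, rows_eq_quasiPoly]
    exact det_quasiPoly_add _ _ (fun l => if (l : ℕ) + 1 = F₁.card + F₂.card
      then F₁.card + F₂.card else (l : ℕ)) j
  have hcons : ∀ j : ℕ, casorati (Fin.cons s r : Fin (F₁.card + F₂.card + 1) → ℕ → RatFunc ℝ) j
      = b ^ j * shift j (algebraMap ℝ[X] (RatFunc ℝ) (excMeixner a c F₁ F₂ n)) := by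
    intro j
    have e : ∀ i l, (Fin.cons s r : Fin (F₁.card + F₂.card + 1) → ℕ → RatFunc ℝ) i l
        = algebraMap ℝ[X] (RatFunc ℝ) ((Fin.cons (fun l => meixnerShift a c m l) (rows a c F₁ F₂) :
          Fin (F₁.card + F₂.card + 1) → ℕ → ℝ[X]) i l) := by
      intro i l
      refine Fin.cases ?_ (fun i => ?_) i <;> simp [s, r]
    have hprod : b = RatFunc.C (∏ i, (Fin.cons 1 (rowBase a F₁ F₂) :
        Fin (F₁.card + F₂.card + 1) → ℝ) i) := by
      rw [Fin.prod_univ_succ]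
      simp [hb]
    simp only [casorati, e, excMeixner, cons_rows_eq_quasiPoly, hprod]
    exact det_quasiPoly_add _ _ (fun l => (l : ℕ)) j
  have hne : ∀ j : ℕ, shift j (OmegaR a c F₁ F₂) ≠ 0 := fun j =>
    (map_ne_zero (shift (j : ℝ))).mpr (RatFunc.algebraMap_ne_zero hΩ)
  have hcas0 : ∀ j : ℕ, casorati r j ≠ 0 := fun j => by
    rw [hcas]
    exact mul_ne_zero (pow_ne_zero _ hb0) (hne j)
  have H := casorati_crum hk r s
    (fun j => RatFunc.X + RatFunc.C ((j : ℝ) + 1))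
    (fun j => -(RatFunc.C (1 + a) * (RatFunc.X + RatFunc.C ((j : ℝ) + 1)) + RatFunc.C (a * c)))
    (fun j => RatFunc.C a * (RatFunc.X + RatFunc.C ((j : ℝ) + 1) + RatFunc.C c))
    (fun i => RatFunc.C (a - 1) * RatFunc.C (rowEigenvalue c F₁ F₂ i))
    (RatFunc.C (a - 1) * RatFunc.C (m : ℝ))
    (fun i j => by
      have h := congrArg (algebraMap ℝ[X] (RatFunc ℝ)) (rows_diff c ha₀ F₁ F₂ i j)
      simp only [map_add, map_sub, map_mul, RatFunc.algebraMap_C, RatFunc.algebraMap_X] at h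
      simp only [r, map_add, map_sub, map_mul]
      linear_combination h)
    (fun j => by
      have h := congrArg (algebraMap ℝ[X] (RatFunc ℝ)) (meixnerShift_diff c ha₀ m j)
      simp only [map_add, map_sub, map_mul, RatFunc.algebraMap_C, RatFunc.algebraMap_X] at h
      simp only [s, map_add, map_sub, map_mul]
      linear_combination h)
    (hcas0 1) (hcas0 2)
  have hk1 : ((F₁.card + F₂.card - 1 : ℕ) : ℝ) = ((F₁.card + F₂.card : ℕ) : ℝ) - 1 := by
    rw [Nat.cast_sub hk, Nat.cast_one]
  simp only [hcas, hskip, hcons, hk1] at H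
  have hne1 := hne 1
  have hne2 := hne 2
  -- The Crum identity has its columns based at `x + 1`, so both sides are shifted by one.
  apply (shift 1).toRingHom.injective
  change shift 1 _ = shift 1 _
  have h2 : (1 + 1 : ℝ) = 2 := by norm_num
  have h0 : (1 + -1 : ℝ) = 0 := by norm_num
  rw [D_apply, hNeg, hZero, hPos, delta, Algebra.smul_def, RatFunc.algebraMap_eq_C]
  simp only [map_add, map_sub, map_neg, map_mul, map_div₀, shift_shift, shift_C, shift_X, h2, h0,
    Nat.cast_zero, Nat.cast_one, Nat.cast_ofNat, shift_zero, hnm] at H hne1 hne2 ha1 ⊢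
  generalize shift 1 (OmegaR a c F₁ F₂) = o₁ at *
  generalize shift 2 (OmegaR a c F₁ F₂) = o₂ at *
  generalize shift 1 (LambdaR a c F₁ F₂) = l₁ at *
  generalize shift 2 (LambdaR a c F₁ F₂) = l₂ at *
  generalize algebraMap ℝ[X] (RatFunc ℝ) (excMeixner a c F₁ F₂ n) = m₀ at *
  generalize shift 1 m₀ = m₁ at *
  generalize shift 2 m₀ = m₂ at *
  generalize RatFunc.C (u F₁ F₂ : ℝ) = v at *
  generalize RatFunc.C ((F₁.card + F₂.card : ℕ) : ℝ) = κ at *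
  generalize RatFunc.C (m : ℝ) = μ at *
  generalize RatFunc.C c = d at *
  clear hcas hskip hcons hcas0 hne
  clear_value b
  simp only [map_one, map_zero] at H ha1 ⊢
  field_simp at H ⊢
  linear_combination H

end ExceptionalMeixner

theorem mainTheorem6 (a c : ℝ) (ha₀ : a ≠ 0) (ha₁ : a ≠ 1) (F₁ F₂ : Finset ℕ)
    (hF₁ : ∀ f ∈ F₁, 0 < f) (hF₂ : ∀ f ∈ F₂, 0 < f) (hF : F₁.Nonempty ∨ F₂.Nonempty) :
    ExceptionalMeixner.Omega a c F₁ F₂ ≠ 0 ∧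
    ∀ n ∈ ExceptionalMeixner.sigma F₁ F₂,
      Module.End.HasEigenvector (ExceptionalMeixner.D a c F₁ F₂) (n : ℝ)
        (algebraMap (Polynomial ℝ) (RatFunc ℝ)
          (ExceptionalMeixner.excMeixner a c F₁ F₂ n)) := by
  refine ⟨ExceptionalMeixner.Omega_ne_zero c ha₀ ha₁ F₁ F₂, fun n hn => ?_⟩
  have hle : ExceptionalMeixner.u F₁ F₂ ≤ n := hn.1
  have hk : 0 < F₁.card + F₂.card := by
    rcases hF with h | h <;> have := Finset.card_pos.mpr h <;> omega
  have hnot : n - ExceptionalMeixner.u F₁ F₂ ∉ F₁ := fun h => hn.2 ⟨_, h, by omega⟩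
  exact ⟨Module.End.mem_eigenspace_iff.mpr
      (ExceptionalMeixner.D_excMeixner c ha₀ ha₁ F₁ F₂ hk hle),
    RatFunc.algebraMap_ne_zero (ExceptionalMeixner.excMeixner_ne_zero c ha₀ ha₁ F₁ F₂ hnot)⟩
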